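/- Consider best-first branch-and-bound for maximum independent set on graphs with vertices $v_1,\dots,v_n$. A node of level $i$ of the search tree is an independent subset $S$ of $\{v_1,\dots,v_i\}$, and its potential is $|S|+n-i$. The search starts with the root (level $0$, $S=\emptyset$) as the only open node. In each step it handles an open node of largest potential, ties being broken arbitrarily: if this node has level $n$ the search stops; otherwise the node is replaced by its feasible children, which have level $i+1$ and partial solution $S$ or, if that set is independent, $S\cup\{v_{i+1}\}$. The running time is the number of nodes handled (for the worst tie-breaking), and $\mathbb T(n,p)$ is its expectation on the binomial random graph $\mathcal G(n,p)$. For $k>0$ let $$\gamma(k)=\sup_{0<x\le 1}\exp\Bigl(\min\bigl\{\psi_k(x),\tfrac12\mu_k(1/x)\bigr\}\Bigr),\qquad \psi_k(x)=-x\ln x-(1-x)\ln(1-x)-\tfrac{k x^2}{2},$$ where $0\ln 0=0$, and $\mu_k(\lambda)=2\ln 2+\lambda-(k+1)+(\lambda-1)\ln\frac{k}{\lambda-1}$ if $\lambda>k+1$, $\mu_k(\lambda)=2\ln 2$ if $1\le\lambda\le k+1$. Theorem. (i) There are constants $C,d$ such that $\mathbb T(n,k/n)\le C\,n^{d}\,\gamma(k)^n$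 for all real $k>0$ and all integers $n\ge 1$ with $k\le n$. (ii) There is a constant $C$ such that $\mathbb T(n,k/n)\le C\cdot 1.867^n$ for all such $k$ and $n$. (iii) $\gamma(k)\le\gamma(0.47)+0.001$ for all $k>0$, $\gamma(0.47)\le 1.867$, and $\gamma(k)\le 1.867$ for all $k>0$. (iv) $\gamma(k)\to 1$ as $k\to 0^+$ and as $k\to\infty$. -/

import Mathlib

namespace BranchAndBound

/-- A node of the search tree for the vertices `v_0, …, v_{n-1}`: the vertices `v_j` with
`j < level` have been decided, and those in `chosen` are the ones that were taken. -/
@[ext]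
structure Node (n : ℕ) where
  level : ℕ
  chosen : Finset (Fin n)

/-- The potential (evaluation) of a node: the size of the partial solution plus the number of
vertices that are still undecided. -/
def Node.potential {n : ℕ} (t : Node n) : ℕ := t.chosen.card + (n - t.level)

/-- The root: nothing has been decided. -/
def root (n : ℕ) : Node n := ⟨0, ∅⟩

open Classical in
/-- The feasible children of a node of level less than `n`: the next vertex is either rejected, or
taken provided that the partial solution remains an independent set of `G`.
A node of level `n` (a global solution) has no children. -/
noncomputable def children {n : ℕ} (G : SimpleGraph (Fin n)) (t : Node n) : Finset (Node n) :=
  if h : t.level < n then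
    if G.IsIndepSet (↑(insert ⟨t.level, h⟩ t.chosen) : Set (Fin n)) then
      {⟨t.level + 1, t.chosen⟩, ⟨t.level + 1, insert ⟨t.level, h⟩ t.chosen⟩}
    else {⟨t.level + 1, t.chosen⟩}
  else ∅

/-- `t` is a node of largest potential among the open nodes `F`. -/
def IsBest {n : ℕ} (F : Finset (Node n)) (t : Node n) : Prop :=
  t ∈ F ∧ ∀ t' ∈ F, t'.potential ≤ t.potential

open Classical in
/-- `Run G F c`: from the set `F` of open nodes, the best-first branch-and-bound search for a
maximum independent set of `G` can stop after having handled exactly `c` nodes. In each step an open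
node of largest potential is handled (ties are broken arbitrarily). If it is a global solution, the
search stops, all the other open nodes being pruned; otherwise it is replaced by its feasible
children. -/
inductive Run {n : ℕ} (G : SimpleGraph (Fin n)) : Finset (Node n) → ℕ → Prop
  | finish (F : Finset (Node n)) (t : Node n) (best : IsBest F t) (leaf : t.level = n) : Run G F 1
  | expand (F : Finset (Node n)) (t : Node n) (c : ℕ) (best : IsBest F t) (inner : t.level < n)
      (rest : Run G (F.erase t ∪ children G t) c) : Run G F (c + 1)

theorem sum_children_lt {n : ℕ} (G : SimpleGraph (Fin n)) (t : Node n) (h : t.level < n) :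
    ∑ s ∈ children G t, 3 ^ (n - s.level) < 3 ^ (n - t.level) := by
  classical
  have key : 3 ^ (n - t.level) = 3 * 3 ^ (n - (t.level + 1)) := by
    rw [← pow_succ']; congr 1; omega
  have hp : 0 < 3 ^ (n - (t.level + 1)) := by positivity
  unfold children
  rw [dif_pos h]
  split_ifs
  · refine lt_of_le_of_lt (Finset.sum_le_card_nsmul _ _ (3 ^ (n - (t.level + 1))) ?_) ?_
    · intro s hs
      simp only [Finset.mem_insert, Finset.mem_singleton] at hs
      rcases hs with rfl | rfl <;> exact le_rfl
    · have := Finset.card_le_two (a := (⟨t.level + 1, t.chosen⟩ : Node n))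
        (b := ⟨t.level + 1, insert ⟨t.level, h⟩ t.chosen⟩)
      rw [smul_eq_mul, key]
      nlinarith
  · simp only [Finset.sum_singleton]
    omega

/-- The search always stops, whatever the graph is. -/
theorem exists_run {n : ℕ} (G : SimpleGraph (Fin n)) : ∃ c, Run G {root n} c := by
  classical
  have main : ∀ N : ℕ, ∀ F : Finset (Node n), F.Nonempty → (∀ t ∈ F, t.level ≤ n) →
      ∑ s ∈ F, 3 ^ (n - s.level) ≤ N → ∃ c, Run G F c := by
    intro N
    induction N with
    | zero =>
      intro F ⟨t, ht⟩ _ hN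
      have := Finset.single_le_sum (f := fun s : Node n => 3 ^ (n - s.level))
        (fun _ _ => Nat.zero_le _) ht
      have : 0 < 3 ^ (n - t.level) := by positivity
      omega
    | succ N ih =>
      intro F hF hlev hN
      obtain ⟨t, ht, hbest⟩ := F.exists_max_image Node.potential hF
      rcases (hlev t ht).eq_or_lt with hl | hl
      · exact ⟨1, Run.finish F t ⟨ht, hbest⟩ hl⟩
      · have hmem : ∀ s ∈ children G t, s.level = t.level + 1 := by
          intro s hs
          unfold children at hs
          rw [dif_pos hl] at hs
          split_ifs at hs
          · simp only [Finset.mem_insert, Finset.mem_singleton] at hs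
            rcases hs with rfl | rfl <;> rfl
          · simp only [Finset.mem_singleton] at hs
            rw [hs]
        have hne : (children G t).Nonempty := by
          unfold children
          rw [dif_pos hl]
          split_ifs <;> simp
        obtain ⟨c, hc⟩ := ih (F.erase t ∪ children G t) (hne.mono Finset.subset_union_right)
          (by
            intro s hs
            rcases Finset.mem_union.1 hs with hs | hs
            · exact hlev s (Finset.mem_of_mem_erase hs)
            · rw [hmem s hs]; omega)
          (by
            have h1 := Finset.sum_union_inter (s₁ := F.erase t) (s₂ := children G t)
              (f := fun s : Node n => 3 ^ (n - s.level))
            have h2 := Finset.add_sum_erase F (fun s : Node n => 3 ^ (n - s.level)) ht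
            have h3 := sum_children_lt G t hl
            omega)
        exact ⟨c + 1, Run.expand F t c ⟨ht, hbest⟩ hl hc⟩
  exact main _ {root n} (Finset.singleton_nonempty _) (by simp [root]) le_rfl

/-- The running time on `G`: the number of nodes of the search tree that are handled when the
search is started at the root, for the worst way of breaking ties. -/
noncomputable def runningTime {n : ℕ} (G : SimpleGraph (Fin n)) : ENat :=
  ⨆ (c : ℕ) (_ : Run G {root n} c), (c : ENat)

/-- The average running time on a binomial random graph with parameters `(n, p)`. -/
noncomputable def averageRunningTime (n : ℕ) (p : unitInterval) : ENNReal :=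
  ∫⁻ G, (runningTime G : ENNReal) ∂(SimpleGraph.binomialRandom (Fin n) p)

/-- The exponent `ψ` coming from the number of independent sets, at relative potential `x`. -/
noncomputable def psi (k x : ℝ) : ℝ :=
  - x * Real.log x - (1 - x) * Real.log (1 - x) - k * x ^ 2 / 2

/-- The exponent `μ` coming from the tail of the number of edges, as a function of `l = 1 / x` for
the relative potential `x`. For `l ≤ k + 1` the tail event is not a large deviation and
only the trivial bound is left. -/
noncomputable def mu (k l : ℝ) : ℝ :=
  if k + 1 < l then 2 * Real.log 2 + l - (k + 1) + (l - 1) * Real.log (k / (l - 1))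
  else 2 * Real.log 2

/-- The base `γ(k) = sup_{0 < x ≤ 1} exp (min (ψ(x), μ(1/x) / 2))` of the exponential bound. -/
noncomputable def gamma (k : ℝ) : ℝ :=
  sSup ((fun x : ℝ => Real.exp (min (psi k x) (mu k (1 / x) / 2))) '' Set.Ioc 0 1)

end BranchAndBound

/-!
The open nodes always cover all independent sets, so a handled node has an independent partial
solution `S` and a potential `b` of at least the independence number. There are two ways of bounding
the expected number of such nodes with `b = x * n`: the expected number of independent sets `S`
gives `exp (ψ(x) * n)`, while Turán's theorem turns a small independence number into many edges, so
that the Chernoff bound gives `exp (μ(1 / x) / 2 * n)`. Only polynomially many pairs of a level and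
a size have to be added up.

For the bounds on `γ`, replace the minimum of the two exponents by `3/4 * ψ + 1/4 * (μ / 2)` and
linearise `μ` at a point depending on `x` at which `k` cancels; this leaves one inequality in `x`.
-/

namespace BranchAndBound

section SearchTree

variable {n : ℕ} {G : SimpleGraph (Fin n)} {s t u : Node n}

/-- The ancestor order of the search tree: every decision taken at `t` is taken at `u` as well.
It is only a preorder because `chosen` may contain vertices that are not decided yet. -/
instance : Preorder (Node n) where
  le t u := t.level ≤ u.level ∧ ∀ j : Fin n, (j : ℕ) < t.level → (j ∈ t.chosen ↔ j ∈ u.chosen)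
  le_refl _ := ⟨le_rfl, fun _ _ => Iff.rfl⟩
  le_trans _ _ _ h h' :=
    ⟨h.1.trans h'.1, fun j hj => (h.2 j hj).trans (h'.2 j (hj.trans_le h.1))⟩

theorem Node.level_le_of_le (h : t ≤ u) : t.level ≤ u.level := h.1

theorem Node.mem_chosen_iff_of_le (h : t ≤ u) {j : Fin n} (hj : (j : ℕ) < t.level) :
    j ∈ t.chosen ↔ j ∈ u.chosen := h.2 j hj

theorem Node.le_of_le_of_le_of_level_le (hs : s ≤ u) (ht : t ≤ u) (h : s.level ≤ t.level) :
    s ≤ t :=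
  ⟨h, fun _ hj => (mem_chosen_iff_of_le hs hj).trans
    (mem_chosen_iff_of_le ht (hj.trans_le h)).symm⟩

/-- The vertices decided at level `i`. -/
def decided (n i : ℕ) : Finset (Fin n) := {j | (j : ℕ) < i}

theorem mem_decided {i : ℕ} {j : Fin n} : j ∈ decided n i ↔ (j : ℕ) < i := by simp [decided]

theorem card_decided {i : ℕ} (h : i ≤ n) : (decided n i).card = i := by
  rw [decided, Fin.card_filter_val_lt, min_eq_right h]

/-- The tree of all decisions, feasible or not: the search tree of the edgeless graph. -/
def decisionTree (n : ℕ) : Finset (Node n) :=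
  ((Finset.range (n + 1)).sigma fun i => (decided n i).powerset).map
    ⟨fun q => ⟨q.1, q.2⟩, by rintro ⟨i, S⟩ ⟨j, T⟩ h; cases h; rfl⟩

theorem mem_decisionTree :
    t ∈ decisionTree n ↔ t.level ≤ n ∧ t.chosen ⊆ decided n t.level := by
  simp only [decisionTree, Finset.mem_map, Finset.mem_sigma, Finset.mem_range, Finset.mem_powerset,
    Nat.lt_succ_iff]
  constructor
  · rintro ⟨q, hq, rfl⟩
    exact hq
  · exact fun ht => ⟨⟨t.level, t.chosen⟩, ht, rfl⟩

theorem sum_decisionTree {M : Type*} [AddCommMonoid M] (f : Node n → M) :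
    ∑ t ∈ decisionTree n, f t =
      ∑ i ∈ Finset.range (n + 1), ∑ S ∈ (decided n i).powerset, f ⟨i, S⟩ := by
  rw [decisionTree, Finset.sum_map, Finset.sum_sigma]
  rfl

theorem eq_of_le_of_level_eq (ht : t ∈ decisionTree n) (hu : u ∈ decisionTree n) (h : t ≤ u)
    (hlevel : t.level = u.level) : t = u := by
  refine Node.ext hlevel (Finset.ext fun j => ?_)
  by_cases hj : (j : ℕ) < t.level
  · exact Node.mem_chosen_iff_of_le h hj
  · exact iff_of_false (fun hjt => hj (mem_decided.1 ((mem_decisionTree.1 ht).2 hjt)))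
      fun hju => hj (hlevel ▸ mem_decided.1 ((mem_decisionTree.1 hu).2 hju))

theorem potential_le_of_le (hu : u ∈ decisionTree n) (h : t ≤ u) : u.potential ≤ t.potential := by
  obtain ⟨hun, hsub⟩ := mem_decisionTree.1 hu
  have htu : t.level ≤ u.level := Node.level_le_of_le h
  have hdecided : decided n t.level ⊆ decided n u.level := fun j hj =>
    mem_decided.2 ((mem_decided.1 hj).trans_le htu)
  have hchosen : u.chosen ⊆ t.chosen ∪ (decided n u.level \ decided n t.level) := by
    intro j hj
    by_cases hjt : (j : ℕ) < t.level
    · exact Finset.mem_union_left _ ((Node.mem_chosen_iff_of_le h hjt).2 hj)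
    · exact Finset.mem_union_right _
        (Finset.mem_sdiff.2 ⟨hsub hj, fun hjt' => hjt (mem_decided.1 hjt')⟩)
  have hcard := (Finset.card_le_card hchosen).trans (Finset.card_union_le _ _)
  rw [Finset.card_sdiff_of_subset hdecided, card_decided hun, card_decided (htu.trans hun)] at hcard
  unfold Node.potential
  omega

open Classical in
/-- The nodes of the search tree of `G`, whether they are handled or not. -/
noncomputable def searchTree (G : SimpleGraph (Fin n)) : Finset (Node n) :=
  {t ∈ decisionTree n | G.IsIndepSet (t.chosen : Set (Fin n))}

theorem mem_searchTree :
    t ∈ searchTree G ↔ t ∈ decisionTree n ∧ G.IsIndepSet (t.chosen : Set (Fin n)) := by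
  simp only [searchTree, Finset.mem_filter]

/-- The node of level `n` at which exactly the vertices in `I` have been taken. -/
def solution (I : Finset (Fin n)) : Node n := ⟨n, I⟩

theorem solution_mem_decisionTree (I : Finset (Fin n)) : solution I ∈ decisionTree n :=
  mem_decisionTree.2 ⟨le_rfl, fun j _ => mem_decided.2 j.isLt⟩

theorem potential_solution (I : Finset (Fin n)) : (solution I).potential = I.card := by
  simp [solution, Node.potential]

theorem root_mem_searchTree (G : SimpleGraph (Fin n)) : root n ∈ searchTree G :=
  mem_searchTree.2 ⟨mem_decisionTree.2 ⟨Nat.zero_le n, Finset.empty_subset _⟩,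
    by simp [root, SimpleGraph.IsIndepSet]⟩

theorem root_le (t : Node n) : root n ≤ t :=
  ⟨Nat.zero_le _, fun _ hj => absurd hj (Nat.not_lt_zero _)⟩

theorem mem_children (h : t.level < n) :
    u ∈ children G t ↔ u = ⟨t.level + 1, t.chosen⟩ ∨
      G.IsIndepSet (↑(insert ⟨t.level, h⟩ t.chosen) : Set (Fin n)) ∧
        u = ⟨t.level + 1, insert ⟨t.level, h⟩ t.chosen⟩ := by
  unfold children
  rw [dif_pos h]
  split_ifs with hindep <;> simp only [Finset.mem_insert, Finset.mem_singleton, hindep, true_and,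
    false_and, or_false]

theorem level_of_mem_children (h : t.level < n) (hu : u ∈ children G t) :
    u.level = t.level + 1 := by
  rcases (mem_children h).1 hu with rfl | ⟨-, rfl⟩ <;> rfl

theorem le_of_mem_children (h : t.level < n) (hu : u ∈ children G t) : t ≤ u := by
  refine ⟨(level_of_mem_children h hu).symm ▸ Nat.le_succ _, fun j hj => ?_⟩
  rcases (mem_children h).1 hu with rfl | ⟨-, rfl⟩
  · rfl
  · rw [Finset.mem_insert, or_iff_right (fun hjt => hj.ne (congrArg Fin.val hjt))]

theorem mem_searchTree_of_mem_children (h : t.level < n) (ht : t ∈ searchTree G)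
    (hu : u ∈ children G t) : u ∈ searchTree G := by
  obtain ⟨htree, hindep⟩ := mem_searchTree.1 ht
  have hchosen : t.chosen ⊆ decided n (t.level + 1) := fun j hj =>
    mem_decided.2 (Nat.lt_succ_of_lt (mem_decided.1 ((mem_decisionTree.1 htree).2 hj)))
  rcases (mem_children h).1 hu with rfl | ⟨hinsert, rfl⟩
  · exact mem_searchTree.2 ⟨mem_decisionTree.2 ⟨h, hchosen⟩, hindep⟩
  · exact mem_searchTree.2 ⟨mem_decisionTree.2 ⟨h, Finset.insert_subset
      (mem_decided.2 (Nat.lt_succ_self _)) hchosen⟩, hinsert⟩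

theorem exists_mem_children_le_solution (h : t.level < n) (ht : t ∈ decisionTree n)
    {I : Finset (Fin n)} (hI : G.IsIndepSet (I : Set (Fin n))) (htI : t ≤ solution I) :
    ∃ u ∈ children G t, u ≤ solution I := by
  set v : Fin n := ⟨t.level, h⟩
  have decided_or_eq (j : Fin n) (hj : (j : ℕ) < t.level + 1) : (j : ℕ) < t.level ∨ j = v :=
    (Nat.lt_succ_iff_lt_or_eq.1 hj).imp_right fun hj => Fin.ext hj
  have hmem {j : Fin n} (hj : (j : ℕ) < t.level) : j ∈ t.chosen ↔ j ∈ I :=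
    Node.mem_chosen_iff_of_le htI hj
  by_cases hvI : v ∈ I
  · have hsub : insert v t.chosen ⊆ I := Finset.insert_subset hvI fun j hj =>
      (hmem (mem_decided.1 ((mem_decisionTree.1 ht).2 hj))).1 hj
    refine ⟨_, (mem_children h).2 (Or.inr ⟨hI.mono (Finset.coe_subset.2 hsub), rfl⟩),
      h, fun j hj => ⟨fun hjt => hsub hjt, fun hjI => ?_⟩⟩
    rcases decided_or_eq j hj with hjt | rfl
    · exact Finset.mem_insert_of_mem ((hmem hjt).2 hjI)
    · exact Finset.mem_insert_self _ _
  · refine ⟨_, (mem_children h).2 (Or.inl rfl), h, fun j hj => ?_⟩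
    rcases decided_or_eq j hj with hjt | rfl
    · exact hmem hjt
    · exact iff_of_false (fun hvt => (mem_decided.1 ((mem_decisionTree.1 ht).2 hvt)).ne rfl) hvI

/-- The invariant of the search: the open nodes are pairwise incomparable nodes of the search tree
below which every independent set is still to be found. -/
structure IsFrontier (G : SimpleGraph (Fin n)) (F : Finset (Node n)) : Prop where
  subset : F ⊆ searchTree G
  isAntichain : IsAntichain (· ≤ ·) (F : Set (Node n))
  exists_le : ∀ I : Finset (Fin n), G.IsIndepSet (I : Set (Fin n)) → ∃ t ∈ F, t ≤ solution I

theorem isFrontier_singleton_root (G : SimpleGraph (Fin n)) : IsFrontier G {root n} where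
  subset := Finset.singleton_subset_iff.2 (root_mem_searchTree G)
  isAntichain := by simp
  exists_le I _ := ⟨root n, Finset.mem_singleton_self _, root_le _⟩

section Frontier

variable {F : Finset (Node n)}

theorem isAntichain_children (h : t.level < n) (ht : t ∈ searchTree G) :
    IsAntichain (· ≤ ·) (children G t : Set (Node n)) := by
  intro u hu v hv hne huv
  refine hne (eq_of_le_of_level_eq (mem_searchTree.1 (mem_searchTree_of_mem_children h ht hu)).1
    (mem_searchTree.1 (mem_searchTree_of_mem_children h ht hv)).1 huv ?_)
  rw [level_of_mem_children h hu, level_of_mem_children h hv]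

theorem eq_or_le_of_le_of_mem_children (h : t.level < n) (ht : t ∈ searchTree G)
    (hs : s ∈ searchTree G) (hu : u ∈ children G t) (hsu : s ≤ u) : s = u ∨ s ≤ t := by
  rcases (Node.level_le_of_le hsu).eq_or_lt with hlevel | hlevel
  · exact Or.inl (eq_of_le_of_level_eq (mem_searchTree.1 hs).1
      (mem_searchTree.1 (mem_searchTree_of_mem_children h ht hu)).1 hsu hlevel)
  · rw [level_of_mem_children h hu] at hlevel
    exact Or.inr (Node.le_of_le_of_le_of_level_le hsu (le_of_mem_children h hu)
      (Nat.lt_succ_iff.1 hlevel))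

open Classical in
theorem IsFrontier.expand (hF : IsFrontier G F) (ht : t ∈ F) (h : t.level < n) :
    IsFrontier G (F.erase t ∪ children G t) where
  subset := Finset.union_subset ((Finset.erase_subset _ _).trans hF.subset)
    fun _ hu => mem_searchTree_of_mem_children h (hF.subset ht) hu
  isAntichain := by
    rw [Finset.coe_union, isAntichain_union]
    refine ⟨hF.isAntichain.subset (Finset.coe_subset.2 (Finset.erase_subset _ _)),
      isAntichain_children h (hF.subset ht), fun s hs u hu hne => ⟨fun hsu => ?_, fun hus => ?_⟩⟩
    all_goals obtain ⟨hst, hsF⟩ := Finset.mem_erase.1 hs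
    · exact hF.isAntichain hsF ht hst ((eq_or_le_of_le_of_mem_children h (hF.subset ht)
        (hF.subset hsF) hu hsu).resolve_left hne)
    · exact hF.isAntichain ht hsF hst.symm ((le_of_mem_children h hu).trans hus)
  exists_le I hI := by
    obtain ⟨s, hs, hsI⟩ := hF.exists_le I hI
    by_cases hst : s = t
    · obtain ⟨u, hu, huI⟩ := exists_mem_children_le_solution h
        (mem_searchTree.1 (hF.subset ht)).1 hI (hst ▸ hsI)
      exact ⟨u, Finset.mem_union_right _ hu, huI⟩
    · exact ⟨s, Finset.mem_union_left _ (Finset.mem_erase.2 ⟨hst, hs⟩), hsI⟩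

theorem IsFrontier.indepNum_le_potential (hF : IsFrontier G F) (ht : IsBest F t) :
    G.indepNum ≤ t.potential := by
  obtain ⟨I, hI⟩ := G.exists_isNIndepSet_indepNum
  obtain ⟨s, hs, hsI⟩ := hF.exists_le I hI.isIndepSet
  calc G.indepNum = (solution I).potential := by rw [potential_solution, hI.card_eq]
    _ ≤ s.potential := potential_le_of_le (solution_mem_decisionTree I) hsI
    _ ≤ t.potential := ht.2 s hs

open Classical in
/-- The nodes that a best-first search with open nodes `F` may still have to handle. -/
noncomputable def pending (G : SimpleGraph (Fin n)) (F : Finset (Node n)) : Finset (Node n) :=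
  {u ∈ searchTree G | G.indepNum ≤ u.potential ∧ ∃ t ∈ F, t ≤ u}

theorem mem_pending :
    u ∈ pending G F ↔ u ∈ searchTree G ∧ G.indepNum ≤ u.potential ∧ ∃ t ∈ F, t ≤ u := by
  simp only [pending, Finset.mem_filter]

theorem IsFrontier.mem_pending (hF : IsFrontier G F) (ht : IsBest F t) : t ∈ pending G F :=
  BranchAndBound.mem_pending.2 ⟨hF.subset ht.1, hF.indepNum_le_potential ht, t, ht.1, le_rfl⟩

open Classical in
theorem IsFrontier.pending_expand_ssubset (hF : IsFrontier G F) (ht : IsBest F t)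
    (h : t.level < n) : pending G (F.erase t ∪ children G t) ⊂ pending G F := by
  refine (Finset.ssubset_iff_of_subset fun u hu => ?_).2 ⟨t, hF.mem_pending ht, fun htp => ?_⟩
  · obtain ⟨hu, hpot, s, hs, hsu⟩ := BranchAndBound.mem_pending.1 hu
    refine BranchAndBound.mem_pending.2 ⟨hu, hpot, ?_⟩
    rcases Finset.mem_union.1 hs with hs | hs
    · exact ⟨s, Finset.mem_of_mem_erase hs, hsu⟩
    · exact ⟨t, ht.1, (le_of_mem_children h hs).trans hsu⟩
  · obtain ⟨-, -, s, hs, hst⟩ := BranchAndBound.mem_pending.1 htp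
    rcases Finset.mem_union.1 hs with hs | hs
    · exact hF.isAntichain (Finset.mem_of_mem_erase hs) ht.1 (Finset.ne_of_mem_erase hs) hst
    · have := Node.level_le_of_le hst
      rw [level_of_mem_children h hs] at this
      exact Nat.not_succ_le_self _ this

theorem Run.le_card_pending {c : ℕ} (hrun : Run G F c) (hF : IsFrontier G F) :
    c ≤ (pending G F).card := by
  induction hrun with
  | finish F t best _ => exact Finset.card_pos.2 ⟨t, hF.mem_pending best⟩
  | expand F t c best inner _ ih =>
    calc c + 1 ≤ _ := Nat.succ_le_succ (ih (hF.expand best.1 inner))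
      _ ≤ _ := Finset.card_lt_card (hF.pending_expand_ssubset best inner)

end Frontier

open Classical in
theorem runningTime_le_card (G : SimpleGraph (Fin n)) :
    runningTime G ≤ ({t ∈ searchTree G | G.indepNum ≤ t.potential}.card : ℕ) := by
  refine iSup₂_le fun c hrun => Nat.cast_le.2 ?_
  refine (hrun.le_card_pending (isFrontier_singleton_root G)).trans (Finset.card_le_card ?_)
  exact Finset.monotone_filter_right _ fun _ _ hu => hu.1

end SearchTree

section RandomGraph

open MeasureTheory

variable {V : Type*}

theorem isIndepSet_iff_forall_edgeFinset {G : SimpleGraph V} [Fintype G.edgeSet] {S : Finset V} :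
    G.IsIndepSet (S : Set V) ↔ ∀ e ∈ G.edgeFinset, e ∉ S.sym2 := by
  simp only [SimpleGraph.mem_edgeFinset, Sym2.forall, SimpleGraph.mem_edgeSet,
    Finset.mk_mem_sym2_iff, not_and]
  exact ⟨fun h u v huv hu hv => h hu hv huv.ne huv, fun h u hu v hv _ huv => h u v huv hu hv⟩

instance [Countable V] : MeasurableSingletonClass (SimpleGraph V) where
  measurableSet_singleton G := by
    have hpreimage : ({G} : Set (SimpleGraph V)) = SimpleGraph.edgeSet ⁻¹' {G.edgeSet} := by
      ext H
      simp
    rw [hpreimage]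
    exact SimpleGraph.measurable_edgeSet (measurableSet_singleton _)

variable [Fintype V]

open Classical in
theorem sum_prod_edgeFinset {R : Type*} [CommSemiring R] (f g : Sym2 V → R) :
    ∑ G : SimpleGraph V, (∏ e ∈ G.edgeFinset, f e) *
      ∏ e ∈ (⊤ : SimpleGraph V).edgeFinset \ G.edgeFinset, g e =
      ∏ e ∈ (⊤ : SimpleGraph V).edgeFinset, (f e + g e) := by
  rw [Finset.prod_add]
  refine Finset.sum_bij' (fun G _ => G.edgeFinset)
    (fun t _ => SimpleGraph.fromEdgeSet (t : Set (Sym2 V))) ?_ ?_ ?_ ?_ ?_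
  · exact fun G _ => Finset.mem_powerset.2 (SimpleGraph.edgeFinset_mono le_top)
  · exact fun t _ => Finset.mem_univ _
  · exact fun G _ => by rw [SimpleGraph.coe_edgeFinset, SimpleGraph.fromEdgeSet_edgeSet]
  · intro t ht
    ext e
    have hdiag : e ∈ t → ¬ e.IsDiag := fun he => by simpa using Finset.mem_powerset.1 ht he
    simpa using hdiag
  · exact fun G _ => rfl

open Classical in
theorem binomialRandom_real_singleton (p : unitInterval) (G : SimpleGraph V) :
    (SimpleGraph.binomialRandom V p).real {G} =
      (∏ _e ∈ G.edgeFinset, (p : ℝ)) *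
        ∏ _e ∈ (⊤ : SimpleGraph V).edgeFinset \ G.edgeFinset, (1 - p : ℝ) := by
  rw [measureReal_def, SimpleGraph.binomialRandom_singleton, Finset.prod_const, Finset.prod_const,
    Finset.card_sdiff_of_subset (SimpleGraph.edgeFinset_mono le_top),
    SimpleGraph.card_edgeFinset_top_eq_card_choose_two, Nat.card_eq_fintype_card,
    ← SimpleGraph.coe_edgeFinset, Set.ncard_coe_finset]
  simp

open Classical in
theorem integral_prod_edgeFinset_binomialRandom (p : unitInterval) (w : Sym2 V → ℝ) :
    ∫ G, ∏ e ∈ G.edgeFinset, w e ∂SimpleGraph.binomialRandom V p =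
      ∏ e ∈ (⊤ : SimpleGraph V).edgeFinset, (p * w e + (1 - p)) := by
  rw [integral_fintype .of_finite, ← sum_prod_edgeFinset]
  refine Finset.sum_congr rfl fun G _ => ?_
  rw [binomialRandom_real_singleton, smul_eq_mul, Finset.prod_mul_distrib]
  ring

open Classical in
theorem card_filter_mem_sym2_edgeFinset_top (S : Finset V) :
    {e ∈ (⊤ : SimpleGraph V).edgeFinset | e ∈ S.sym2}.card = S.card.choose 2 := by
  rw [← Sym2.card_image_offDiag]
  congr 1
  ext e
  induction e using Sym2.ind with
  | _ u v =>
    simp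
    grind

open Classical in
theorem binomialRandom_real_isIndepSet {V : Type*} [Finite V] (p : unitInterval) (S : Finset V) :
    (SimpleGraph.binomialRandom V p).real {G | G.IsIndepSet (S : Set V)} =
      (1 - p : ℝ) ^ S.card.choose 2 := by
  cases nonempty_fintype V
  have hindicator (G : SimpleGraph V) :
      {G : SimpleGraph V | G.IsIndepSet (S : Set V)}.indicator 1 G =
        ∏ e ∈ G.edgeFinset, if e ∉ S.sym2 then (1 : ℝ) else 0 := by
    rw [Finset.prod_boole]
    by_cases h : G.IsIndepSet (S : Set V)
    · rw [if_pos (isIndepSet_iff_forall_edgeFinset.1 h), Set.indicator_of_mem h, Pi.one_apply]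
    · rw [if_neg (mt isIndepSet_iff_forall_edgeFinset.2 h), Set.indicator_of_notMem h]
  have hfactor (e : Sym2 V) : p * (if e ∉ S.sym2 then (1 : ℝ) else 0) + (1 - p) =
      if e ∈ S.sym2 then (1 - p : ℝ) else 1 := by
    split_ifs <;> simp_all
  rw [← integral_indicator_one (Set.toFinite _).measurableSet, integral_congr_ae
    (.of_forall hindicator), integral_prod_edgeFinset_binomialRandom]
  simp_rw [hfactor]
  rw [Finset.prod_ite, Finset.prod_const, Finset.prod_const_one, mul_one,
    card_filter_mem_sym2_edgeFinset_top]

open Classical in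
theorem mgf_card_edgeFinset_binomialRandom_le (p : unitInterval) (t : ℝ) :
    ProbabilityTheory.mgf (fun G : SimpleGraph V => (G.edgeFinset.card : ℝ))
        (SimpleGraph.binomialRandom V p) t ≤
      Real.exp (p * (Fintype.card V).choose 2 * (Real.exp t - 1)) := by
  have hprod (G : SimpleGraph V) :
      Real.exp (t * G.edgeFinset.card) = ∏ _e ∈ G.edgeFinset, Real.exp t := by
    rw [Finset.prod_const, ← Real.exp_nat_mul, mul_comm]
  have hbase : (p : ℝ) * Real.exp t + (1 - p) ≤ Real.exp (p * (Real.exp t - 1)) := by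
    linarith [Real.add_one_le_exp ((p : ℝ) * (Real.exp t - 1))]
  have hnonneg : 0 ≤ (p : ℝ) * Real.exp t + (1 - p) :=
    add_nonneg (mul_nonneg p.2.1 (Real.exp_pos _).le) (sub_nonneg.2 p.2.2)
  simp only [ProbabilityTheory.mgf, hprod]
  rw [integral_prod_edgeFinset_binomialRandom, Finset.prod_const,
    SimpleGraph.card_edgeFinset_top_eq_card_choose_two]
  calc _ ≤ Real.exp (p * (Real.exp t - 1)) ^ (Fintype.card V).choose 2 :=
        pow_le_pow_left₀ hnonneg hbase _
    _ = _ := by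
        rw [← Real.exp_nat_mul]
        ring_nf

open Classical in
theorem binomialRandom_real_le_card_edgeFinset (p : unitInterval) {m M : ℝ} (hm : 0 < m)
    (hmM : m ≤ M) (hp : (p : ℝ) * (Fintype.card V).choose 2 ≤ m) :
    (SimpleGraph.binomialRandom V p).real {G | M ≤ G.edgeFinset.card} ≤
      Real.exp (M - m + M * Real.log (m / M)) := by
  have hratio : 1 ≤ M / m := (one_le_div hm).2 hmM
  have hexp : Real.exp (Real.log (M / m)) - 1 = (M - m) / m := by
    rw [Real.exp_log (zero_lt_one.trans_le hratio), sub_div, div_self hm.ne']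
  calc (SimpleGraph.binomialRandom V p).real {G | M ≤ G.edgeFinset.card}
      ≤ Real.exp (-Real.log (M / m) * M) * ProbabilityTheory.mgf _ _ (Real.log (M / m)) :=
        ProbabilityTheory.measure_ge_le_exp_mul_mgf M (Real.log_nonneg hratio) .of_finite
    _ ≤ Real.exp (-Real.log (M / m) * M) * Real.exp (M - m) := by
        refine mul_le_mul_of_nonneg_left
          ((mgf_card_edgeFinset_binomialRandom_le _ _).trans (Real.exp_le_exp.2 ?_))
          (Real.exp_pos _).le
        rw [hexp]
        calc _ ≤ m * ((M - m) / m) :=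
              mul_le_mul_of_nonneg_right hp (div_nonneg (sub_nonneg.2 hmM) hm.le)
          _ = M - m := mul_div_cancel₀ _ hm.ne'
    _ = _ := by
        rw [← Real.exp_add, ← Real.log_inv, inv_div]
        ring_nf

open Classical in
theorem two_mul_mul_card_edgeFinset_le_of_cliqueFree {G : SimpleGraph V} {r : ℕ}
    (h : G.CliqueFree (r + 1)) :
    2 * r * G.edgeFinset.card ≤ (r - 1) * Fintype.card V ^ 2 := by
  refine le_trans (Nat.mul_le_mul_left _ ?_)
    (SimpleGraph.mul_card_edgeFinset_turanGraph_le (n := Fintype.card V) (r := r))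
  rw [SimpleGraph.card_edgeFinset_turanGraph]
  exact h.card_edgeFinset_le

open Classical in
theorem two_mul_card_edgeFinset_add_compl (G : SimpleGraph V) :
    2 * (G.edgeFinset.card + Gᶜ.edgeFinset.card) + Fintype.card V = Fintype.card V ^ 2 := by
  have hcompl : G.edgeFinset.card + Gᶜ.edgeFinset.card = (Fintype.card V).choose 2 := by
    rw [← SimpleGraph.card_edgeFinset_top_eq_card_choose_two, ← Finset.card_union_of_disjoint
      (SimpleGraph.disjoint_edgeFinset.2 disjoint_compl_right), ← SimpleGraph.edgeFinset_sup]
    congr!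
    exact sup_compl_eq_top
  rw [hcompl, mul_comm, Nat.choose_two_right, Nat.div_mul_cancel
    (Nat.even_mul_pred_self _).two_dvd]
  cases Fintype.card V
  · rfl
  · rw [Nat.add_sub_cancel]
    ring

open Classical in
theorem sq_card_le_indepNum_mul (G : SimpleGraph V) :
    Fintype.card V ^ 2 ≤ G.indepNum * (2 * G.edgeFinset.card + Fintype.card V) := by
  have hfree : Gᶜ.CliqueFree (G.indepNum + 1) := (SimpleGraph.cliqueFree_compl G).2 fun s hs =>
    (Nat.lt_succ_self _).not_ge (hs.card_eq ▸ hs.isIndepSet.card_le_indepNum)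
  have hturan : 2 * G.indepNum * Gᶜ.edgeFinset.card ≤ (G.indepNum - 1) * Fintype.card V ^ 2 := by
    convert two_mul_mul_card_edgeFinset_le_of_cliqueFree hfree
  have hcard := two_mul_card_edgeFinset_add_compl G
  cases hα : G.indepNum with
  | zero =>
    rw [hα, SimpleGraph.cliqueFree_one] at hfree
    simp
  | succ b =>
    rw [hα, Nat.add_sub_cancel] at hturan
    nlinarith

open Classical in
theorem binomialRandom_real_indepNum_le {k : ℝ} (hk : 0 < k) {p : unitInterval}
    (hp : (p : ℝ) * Fintype.card V ≤ k) {b : ℕ} (hb : k + 1 < (Fintype.card V : ℝ) / b) :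
    (SimpleGraph.binomialRandom V p).real {G | G.indepNum ≤ b} ≤
      Real.exp (Fintype.card V * (mu k (Fintype.card V / b) / 2 - Real.log 2)) := by
  set N : ℝ := (Fintype.card V : ℝ) with hN
  set l : ℝ := N / b with hl
  have hb0 : (0 : ℝ) < b := by
    refine Nat.cast_pos.2 (Nat.pos_of_ne_zero fun hb0 => ?_)
    rw [hl, hb0, Nat.cast_zero, div_zero] at hb
    linarith
  have hNl : N = l * b := (div_mul_cancel₀ _ hb0.ne').symm
  have hl1 : 0 < l - 1 := by linarith
  have hN0 : 0 < N := hNl ▸ mul_pos (by linarith) hb0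
  have hsub : {G : SimpleGraph V | G.indepNum ≤ b} ⊆
      {G | (l - 1) * N / 2 ≤ G.edgeFinset.card} := by
    intro G hG
    have hsq : N ^ 2 ≤ b * (2 * G.edgeFinset.card + N) := by
      rw [hN]
      exact_mod_cast (sq_card_le_indepNum_mul G).trans (Nat.mul_le_mul_right _ hG)
    have : b * (l * N) ≤ b * (2 * G.edgeFinset.card + N) := by
      linear_combination hsq - N * hNl
    have := le_of_mul_le_mul_left this hb0
    simp only [Set.mem_ofPred_eq]
    linarith
  have hmean : (p : ℝ) * (Fintype.card V).choose 2 ≤ k * N / 2 := by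
    rw [Nat.cast_choose_two, ← hN]
    nlinarith [mul_nonneg p.2.1 hN0.le]
  refine (measureReal_mono hsub).trans ((binomialRandom_real_le_card_edgeFinset p
    (by positivity) (by nlinarith) hmean).trans_eq ?_)
  have hratio : k * N / 2 / ((l - 1) * N / 2) = k / (l - 1) := by
    field_simp
  rw [hratio, mu, if_pos hb]
  ring_nf

end RandomGraph

section Gamma

open Real

theorem concaveOn_binEntropy_add_sq :
    ConcaveOn ℝ (Set.Icc 0 1) fun x : ℝ => binEntropy x + 2 * (x - 1 / 2) ^ 2 := by
  refine concaveOn_of_hasDerivWithinAt2_nonpos (convex_Icc 0 1) (by fun_prop)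
    (f' := fun x => log (1 - x) - log x + 4 * (x - 1 / 2))
    (f'' := fun x => -1 / (1 - x) - 1 / x + 4) ?_ ?_ ?_
  all_goals
    intro x hx
    rw [interior_Icc] at hx
    obtain ⟨h0, h1⟩ := hx
  · have hsq := (((hasDerivAt_id x).sub_const (1 / 2)).pow 2).const_mul 2
    refine (((hasDerivAt_binEntropy h0.ne' h1.ne).add hsq).congr_deriv ?_).hasDerivWithinAt
    norm_num
    ring
  · have hlog := ((hasDerivAt_id x).const_sub 1).log (sub_pos.2 h1).ne'
    have hlinear := ((hasDerivAt_id x).sub_const (1 / 2)).const_mul 4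
    refine (((hlog.sub (hasDerivAt_log h0.ne')).add hlinear).congr_deriv ?_).hasDerivWithinAt
    simp only [id]
    ring
  · have : 0 < 1 - x := sub_pos.2 h1
    have hsq : -1 / (1 - x) - 1 / x + 4 = -((2 * x - 1) ^ 2 / (x * (1 - x))) := by
      field_simp
      ring
    rw [hsq]
    exact neg_nonpos.2 (by positivity)

theorem binEntropy_le_log_two_sub_sq {x : ℝ} (hx : x ∈ Set.Icc (0 : ℝ) 1) :
    binEntropy x ≤ log 2 - 2 * (x - 1 / 2) ^ 2 := by
  have hmid := concaveOn_binEntropy_add_sq.2 hx ⟨sub_nonneg.2 hx.2, sub_le_self 1 hx.1⟩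
    (by norm_num : (0 : ℝ) ≤ 1 / 2) (by norm_num : (0 : ℝ) ≤ 1 / 2) (by norm_num)
  have hhalf : 1 / 2 * x + 1 / 2 * (1 - x) = 2⁻¹ := by ring
  simp only [smul_eq_mul, hhalf, binEntropy_two_inv, binEntropy_one_sub] at hmid
  norm_num at hmid ⊢
  linarith

theorem exists_binEntropy_le {ε : ℝ} (hε : 0 < ε) :
    ∃ δ > 0, ∀ x, 0 ≤ x → x < δ → binEntropy x ≤ ε := by
  have hlim := binEntropy_continuous.tendsto 0
  rw [binEntropy_zero] at hlim
  obtain ⟨δ, hδ, h⟩ := Metric.eventually_nhds_iff.1 (hlim.eventually (gt_mem_nhds hε))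
  refine ⟨δ, hδ, fun x h0 hx => (h ?_).le⟩
  rwa [Real.dist_eq, sub_zero, abs_of_nonneg h0]

theorem psi_eq_binEntropy_sub (k x : ℝ) : psi k x = binEntropy x - k * x ^ 2 / 2 := by
  rw [psi, binEntropy_eq_negMulLog_add_negMulLog_one_sub, negMulLog, negMulLog]
  ring

theorem psi_le_binEntropy {k : ℝ} (hk : 0 ≤ k) (x : ℝ) : psi k x ≤ binEntropy x := by
  rw [psi_eq_binEntropy_sub]
  exact sub_le_self _ (by positivity)

theorem psi_le_log_two {k : ℝ} (hk : 0 ≤ k) (x : ℝ) : psi k x ≤ log 2 :=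
  (psi_le_binEntropy hk x).trans binEntropy_le_log_two

theorem mu_of_lt {k l : ℝ} (h : k + 1 < l) :
    mu k l = 2 * log 2 + l - (k + 1) + (l - 1) * log (k / (l - 1)) := if_pos h

theorem mu_of_le {k l : ℝ} (h : l ≤ k + 1) : mu k l = 2 * log 2 := if_neg h.not_gt

-- The bound is attained at `u = (l - 1) / k` when `k + 1 ≤ l`: `μ` is a Legendre transform.
theorem mu_le {k u : ℝ} (hk : 0 < k) (hu : 1 ≤ u) (l : ℝ) :
    mu k l ≤ 2 * log 2 + k * (u - 1) - (l - 1) * log u := by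
  have hu0 : 0 < u := one_pos.trans_le hu
  rcases le_or_gt l (k + 1) with hl | hl
  · rw [mu_of_le hl]
    have hlog : (l - 1) * log u ≤ k * (u - 1) :=
      mul_le_mul (by linarith) (log_le_sub_one_of_pos hu0) (log_nonneg hu) hk.le
    linarith
  · have hl1 : 0 < l - 1 := by linarith
    have htangent := log_le_sub_one_of_pos (mul_pos (div_pos hk hl1) hu0)
    rw [log_mul (div_pos hk hl1).ne' hu0.ne'] at htangent
    have hmul := mul_le_mul_of_nonneg_left htangent hl1.le
    have hcancel : (l - 1) * (k / (l - 1)) = k := mul_div_cancel₀ _ hl1.ne'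
    rw [mu_of_lt hl]
    linear_combination hmul + u * hcancel

theorem exp_min_le_gamma {k x : ℝ} (hk : 0 ≤ k) (hx : x ∈ Set.Ioc (0 : ℝ) 1) :
    exp (min (psi k x) (mu k (1 / x) / 2)) ≤ gamma k := by
  refine le_csSup ⟨exp (log 2), ?_⟩ ⟨x, hx, rfl⟩
  rintro _ ⟨y, _, rfl⟩
  exact exp_le_exp.2 ((min_le_left _ _).trans (psi_le_log_two hk y))

theorem gamma_le_exp {k c : ℝ}
    (h : ∀ x ∈ Set.Ioc (0 : ℝ) 1, min (psi k x) (mu k (1 / x) / 2) ≤ c) : gamma k ≤ exp c := by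
  refine csSup_le ⟨_, 1, ⟨one_pos, le_rfl⟩, rfl⟩ ?_
  rintro _ ⟨x, hx, rfl⟩
  exact exp_le_exp.2 (h x hx)

theorem exp_psi_le_gamma {k x : ℝ} (hk : 0 ≤ k) (hx : x ∈ Set.Ioc (0 : ℝ) 1)
    (h : 1 / x ≤ k + 1) : exp (psi k x) ≤ gamma k := by
  have hle : psi k x ≤ mu k (1 / x) / 2 := by
    rw [mu_of_le h]
    linarith [psi_le_log_two hk x]
  simpa only [min_eq_left hle] using exp_min_le_gamma hk hx

theorem one_le_gamma {k : ℝ} (hk : 0 ≤ k) : 1 ≤ gamma k := by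
  set x : ℝ := 1 / (k + 1) with hx
  have hx0 : 0 < x := by positivity
  have hkx : k * x = 1 - x := by
    rw [hx]
    field_simp
    ring
  have hx1 : x ≤ 1 := by linarith [mul_nonneg hk hx0.le]
  refine (one_le_exp ?_).trans (exp_psi_le_gamma hk ⟨hx0, hx1⟩ (by rw [hx, one_div_one_div]))
  have hlog : x * log x ≤ x * (x - 1) :=
    mul_le_mul_of_nonneg_left (log_le_sub_one_of_pos hx0) hx0.le
  have hlog' : (1 - x) * log (1 - x) ≤ 0 :=
    mul_nonpos_of_nonneg_of_nonpos (by linarith) (log_nonpos (by linarith) (by linarith))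
  have hsq : k * x ^ 2 = (1 - x) * x := by rw [sq, ← mul_assoc, hkx]
  rw [psi]
  nlinarith

section Numerics

theorem two_mul_sum_range_le_log {a : ℝ} (ha : 1 ≤ a) (n : ℕ) :
    2 * ∑ i ∈ Finset.range n, ((a - 1) / (a + 1)) ^ (2 * i + 1) / (2 * i + 1) ≤ log a := by
  have hx1 : (a - 1) / (a + 1) < 1 := (div_lt_one (by linarith)).2 (by linarith)
  have h := sum_range_le_log_div (div_nonneg (sub_nonneg.2 ha) (by linarith)) hx1 n
  have hratio : (1 + (a - 1) / (a + 1)) / (1 - (a - 1) / (a + 1)) = a := by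
    field_simp
    ring
  rw [hratio] at h
  linarith

theorem log_le_two_mul_sum_range_add {a : ℝ} (ha : 1 ≤ a) (n : ℕ) :
    log a ≤ 2 * ((∑ i ∈ Finset.range n, ((a - 1) / (a + 1)) ^ (2 * i + 1) / (2 * i + 1)) +
      ((a - 1) / (a + 1)) ^ (2 * n + 1) / (1 - ((a - 1) / (a + 1)) ^ 2)) := by
  have hx1 : (a - 1) / (a + 1) < 1 := (div_lt_one (by linarith)).2 (by linarith)
  have h := log_div_le_sum_range_add (div_nonneg (sub_nonneg.2 ha) (by linarith)) hx1 n
  have hratio : (1 + (a - 1) / (a + 1)) / (1 - (a - 1) / (a + 1)) = a := by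
    field_simp
    ring
  rw [hratio] at h
  linarith

theorem log_two_sub_le_log : log 2 - 0.06893 ≤ log 1.8668 := by
  have h := log_le_two_mul_sum_range_add (a := 2 / 1.8668) (by norm_num) 2
  rw [log_div (by norm_num) (by norm_num)] at h
  norm_num [Finset.sum_range_succ] at h ⊢
  linarith

theorem le_log_eleven_sixths : 0.6061 ≤ log (11 / 6) := by
  have h := two_mul_sum_range_le_log (a := 11 / 6) (by norm_num) 4
  norm_num [Finset.sum_range_succ] at h ⊢
  linarith

-- The quintic almost vanishes at its minimum near `x = 0.526`; its quotient by
-- `(x - 0.526) ^ 2` is the cubic in the proof.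
theorem quintic_nonneg {x : ℝ} (h0 : 0.28 ≤ x) :
    0 ≤ (1.5 * (x - 1 / 2) ^ 2 - 0.06893) * (8 * x * (1 + 3 * x ^ 2)) +
      (1 - x) * (1.6061 * (1 + 3 * x ^ 2) - 11 / 6) := by
  have hcubic : 0 ≤ 36 * x ^ 3 + 1.872 * x ^ 2 + 6.536388 * x - 0.823357296 := by
    have hx3 : 0 ≤ x ^ 3 := by positivity
    have hx2 : 0 ≤ x ^ 2 := by positivity
    linarith
  nlinarith [mul_nonneg (sq_nonneg (x - 0.526)) hcubic]

-- In `3/4 * ψ + 1/4 * μ/2`, with `μ` bounded by `mu_le` at `u = 1 + 3 * x ^ 2`, the terms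
-- involving `k` cancel.
theorem min_psi_half_mu_le {k x : ℝ} (hk : 0 < k) :
    min (psi k x) (mu k (1 / x) / 2) ≤
      3 / 4 * binEntropy x + 1 / 4 * log 2 - (1 / x - 1) * log (1 + 3 * x ^ 2) / 8 := by
  have hmu := mu_le hk (by nlinarith : 1 ≤ 1 + 3 * x ^ 2) (1 / x)
  have hmin_psi := min_le_left (psi k x) (mu k (1 / x) / 2)
  have hmin_mu := min_le_right (psi k x) (mu k (1 / x) / 2)
  linarith [psi_eq_binEntropy_sub k x]

theorem min_psi_half_mu_le_log_two_sub {k x : ℝ} (hk : 0 < k) (hx : x ∈ Set.Ioc (0 : ℝ) 1) :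
    min (psi k x) (mu k (1 / x) / 2) ≤ log 2 - 0.06893 := by
  obtain ⟨h0, h1⟩ := hx
  have hl1 : 0 ≤ 1 / x - 1 := sub_nonneg.2 ((one_le_div h0).2 h1)
  have hu : 1 ≤ 1 + 3 * x ^ 2 := by nlinarith
  have hmin := min_psi_half_mu_le (x := x) hk
  have hentropy := binEntropy_le_log_two_sub_sq ⟨h0.le, h1⟩
  rcases lt_or_ge x 0.28 with hx | hx
  · have hnonneg : 0 ≤ (1 / x - 1) * log (1 + 3 * x ^ 2) := mul_nonneg hl1 (log_nonneg hu)
    nlinarith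
  · have htangent : 1.6061 - 11 / 6 / (1 + 3 * x ^ 2) ≤ log (1 + 3 * x ^ 2) := by
      have h := log_le_sub_one_of_pos (x := 11 / 6 / (1 + 3 * x ^ 2)) (by positivity)
      rw [log_div (by norm_num) (by positivity)] at h
      linarith [le_log_eleven_sixths]
    have hmul := mul_le_mul_of_nonneg_left htangent hl1
    have hquintic : 0 ≤ 1.5 * (x - 1 / 2) ^ 2 - 0.06893 +
        (1 / x - 1) * (1.6061 - 11 / 6 / (1 + 3 * x ^ 2)) / 8 := by
      have h := div_nonneg (quintic_nonneg hx) (by positivity : 0 ≤ 8 * x * (1 + 3 * x ^ 2))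
      refine h.trans_eq ?_
      field_simp
    linarith

theorem gamma_le {k : ℝ} (hk : 0 < k) : gamma k ≤ 1.8668 := by
  rw [← exp_log (by norm_num : (0 : ℝ) < 1.8668)]
  exact gamma_le_exp fun x hx => (min_psi_half_mu_le_log_two_sub hk hx).trans log_two_sub_le_log

-- At `x = 0.5335` both exponents are slightly larger than `log 1.866`.
theorem le_gamma_zero_point_forty_seven : 1.866 ≤ gamma 0.47 := by
  refine le_trans ?_ (exp_min_le_gamma (x := 0.5335) (by norm_num) ⟨by norm_num, by norm_num⟩)
  rw [← log_le_iff_le_exp (by norm_num)]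
  have hlog_1067 := log_le_two_mul_sum_range_add (a := 1.067) (by norm_num) 2
  have hlog_933 := two_mul_sum_range_le_log (a := 1 / 0.933) (by norm_num) 2
  have hlog_1075 := two_mul_sum_range_le_log (a := 1.075) (by norm_num) 2
  have hlog_two_lt := log_two_lt_d9
  have hlog_two_gt := log_two_gt_d9
  rw [one_div, log_inv] at hlog_933
  have hx : log 0.5335 = log 1.067 - log 2 := by
    rw [← log_div (by norm_num) (by norm_num)]
    norm_num
  have hx' : log (1 - 0.5335) = log 0.933 - log 2 := by
    rw [← log_div (by norm_num) (by norm_num)]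
    norm_num
  have hbase : log 1.866 = log 0.933 + log 2 := by
    rw [← log_mul (by norm_num) (by norm_num)]
    norm_num
  have hratio : log 1.075 - log 2 ≤ log (0.47 / (1 / 0.5335 - 1)) := by
    rw [← log_div (by norm_num) (by norm_num)]
    exact log_le_log (by norm_num) (by norm_num)
  refine le_min ?_ ?_
  · rw [psi, hx, hx', hbase]
    norm_num [Finset.sum_range_succ] at hlog_1067 hlog_933 ⊢
    linarith
  · rw [mu_of_lt (by norm_num), hbase]
    norm_num [Finset.sum_range_succ] at hlog_933 hlog_1075 hratio ⊢
    linarith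

end Numerics

section Limits

theorem tendsto_gamma_of_le {l : Filter ℝ} (hl : ∀ᶠ k in l, 0 ≤ k)
    (h : ∀ ε > 0, ∀ᶠ k in l, ∀ x ∈ Set.Ioc (0 : ℝ) 1, min (psi k x) (mu k (1 / x) / 2) ≤ ε) :
    Filter.Tendsto gamma l (nhds 1) := by
  refine tendsto_order.2 ⟨fun a ha => ?_, fun a ha => ?_⟩
  · filter_upwards [hl] with k hk using ha.trans_le (one_le_gamma hk)
  · have hlog := log_pos ha
    filter_upwards [h (log a / 2) (half_pos hlog)] with k hk
    calc gamma k ≤ exp (log a / 2) := gamma_le_exp hk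
      _ < a := (lt_log_iff_exp_lt (one_pos.trans ha)).1 (half_lt_self hlog)

theorem tendsto_gamma_atTop : Filter.Tendsto gamma Filter.atTop (nhds 1) := by
  refine tendsto_gamma_of_le (Filter.eventually_ge_atTop 0) fun ε hε => ?_
  obtain ⟨δ, hδ, hentropy⟩ := exists_binEntropy_le hε
  filter_upwards [Filter.eventually_ge_atTop (2 * log 2 / δ ^ 2), Filter.eventually_ge_atTop 0]
    with k hk hk0 x hx
  refine (min_le_left _ _).trans ?_
  rcases lt_or_ge x δ with hxδ | hxδ
  · exact (psi_le_binEntropy hk0 x).trans (hentropy x hx.1.le hxδ)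
  · have hquad : 2 * log 2 ≤ k * x ^ 2 := by
      calc 2 * log 2 ≤ k * δ ^ 2 := (div_le_iff₀ (by positivity)).1 hk
        _ ≤ k * x ^ 2 := by gcongr
    rw [psi_eq_binEntropy_sub]
    linarith [binEntropy_le_log_two (p := x)]

theorem tendsto_gamma_zero :
    Filter.Tendsto gamma (nhdsWithin 0 (Set.Ioi 0)) (nhds 1) := by
  have hpos : ∀ᶠ k in nhdsWithin (0 : ℝ) (Set.Ioi 0), 0 < k := self_mem_nhdsWithin
  refine tendsto_gamma_of_le (hpos.mono fun _ => le_of_lt) fun ε hε => ?_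
  obtain ⟨δ, hδ, hentropy⟩ := exists_binEntropy_le hε
  -- Large enough for `mu_le` at `u` to absorb the term `2 * log 2` as soon as `δ ≤ 1 / x - 1`.
  set u : ℝ := exp (2 * log 2 / δ) with hu
  have hu0 : 0 < u := exp_pos _
  filter_upwards [hpos, nhdsWithin_le_nhds (Iic_mem_nhds (by positivity : 0 < 2 * ε / u))]
    with k hk hku x ⟨hx0, hx1⟩
  rcases lt_or_ge (1 - x) δ with hxδ | hxδ
  · calc min (psi k x) (mu k (1 / x) / 2) ≤ psi k x := min_le_left _ _
      _ ≤ binEntropy x := psi_le_binEntropy hk.le x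
      _ = binEntropy (1 - x) := (binEntropy_one_sub x).symm
      _ ≤ ε := hentropy (1 - x) (sub_nonneg.2 hx1) hxδ
  · have hl : δ ≤ 1 / x - 1 := by
      have h : δ ≤ (1 - x) / x := hxδ.trans (le_div_self (sub_nonneg.2 hx1) hx0 hx1)
      rwa [sub_div, div_self hx0.ne'] at h
    have hlog : 2 * log 2 ≤ (1 / x - 1) * log u := by
      calc 2 * log 2 = δ * log u := by rw [hu, log_exp, mul_div_cancel₀ _ hδ.ne']
        _ ≤ (1 / x - 1) * log u := mul_le_mul_of_nonneg_right hl (by rw [hu, log_exp]; positivity)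
    have hku' : k * u ≤ 2 * ε := (le_div_iff₀ hu0).1 hku
    have hmu := mu_le hk (one_le_exp (by positivity) : 1 ≤ u) (1 / x)
    exact (min_le_right _ _).trans (by linarith)

end Limits

end Gamma

section AverageRunningTime

open MeasureTheory

open Classical in
theorem averageRunningTime_le_sum (n : ℕ) (p : unitInterval) :
    averageRunningTime n p ≤ ENNReal.ofReal (∑ t ∈ decisionTree n,
      (SimpleGraph.binomialRandom (Fin n) p).real
        {G | G.IsIndepSet (t.chosen : Set (Fin n)) ∧ G.indepNum ≤ t.potential}) := by
  have hmeas (s : Set (SimpleGraph (Fin n))) : MeasurableSet s := s.toFinite.measurableSet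
  calc averageRunningTime n p
      ≤ ∫⁻ G, ∑ t ∈ decisionTree n, Set.indicator
          {G : SimpleGraph (Fin n) | G.IsIndepSet (t.chosen : Set (Fin n)) ∧
            G.indepNum ≤ t.potential} 1 G ∂SimpleGraph.binomialRandom (Fin n) p := by
        refine lintegral_mono fun G => (ENat.toENNReal_mono (runningTime_le_card G)).trans_eq ?_
        rw [searchTree, Finset.filter_filter, Finset.card_filter]
        simp [Set.indicator_apply]
    _ = _ := by
        rw [lintegral_finsetSum _ fun t _ => measurable_one.indicator (hmeas _),
          ENNReal.ofReal_sum_of_nonneg fun t _ => measureReal_nonneg]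
        refine Finset.sum_congr rfl fun t _ => ?_
        rw [lintegral_indicator_one (hmeas _), ofReal_measureReal]

theorem choose_mul_pow_mul_pow_le_one {z : ℝ} (h0 : 0 ≤ z) (h1 : z ≤ 1) (t m : ℕ) :
    (z ^ t * (1 - z) ^ m) * (t + m).choose t ≤ 1 := by
  have : 0 ≤ 1 - z := sub_nonneg.2 h1
  have hterm := Finset.single_le_sum
    (f := fun i => z ^ i * (1 - z) ^ (t + m - i) * ((t + m).choose i : ℝ))
    (fun i _ => by positivity) (Finset.mem_range.2 (by omega : t < t + m + 1))
  rwa [← add_pow, add_sub_cancel, one_pow, Nat.add_sub_cancel_left] at hterm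

theorem choose_le_exp {z : ℝ} (h0 : 0 < z) (h1 : z ≤ 1) (t : ℕ) {m : ℕ} (hm : z = 1 → m = 0) :
    ((t + m).choose t : ℝ) ≤ Real.exp (-t * Real.log z - m * Real.log (1 - z)) := by
  rcases h1.eq_or_lt with rfl | h1
  · simp [hm rfl]
  · have hpow : z ^ t * (1 - z) ^ m = Real.exp (t * Real.log z + m * Real.log (1 - z)) := by
      rw [Real.exp_add, Real.exp_nat_mul, Real.exp_nat_mul, Real.exp_log h0,
        Real.exp_log (sub_pos.2 h1)]
    have hle := choose_mul_pow_mul_pow_le_one h0.le h1.le t m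
    rw [hpow, ← le_div_iff₀' (Real.exp_pos _), one_div, ← Real.exp_neg] at hle
    refine hle.trans_eq (congrArg Real.exp ?_)
    ring

theorem entropy_sub_le_psi {k x y z : ℝ} (hk : 0 ≤ k) (h0 : 0 < z) (hyz : y ≤ z) (hzx : z ≤ x)
    (hx : x ≤ 1) (hz : z = y ∨ (k + 1) * z ≤ 1) :
    -y * Real.log z - (1 - x) * Real.log (1 - z) - k * y ^ 2 / 2 ≤ psi k z := by
  have hreject : (x - z) * Real.log (1 - z) ≤ 0 :=
    mul_nonpos_of_nonneg_of_nonpos (by linarith) (Real.log_nonpos (by linarith) (by linarith))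
  have htake : (z - y) * (Real.log z + k * (z + y) / 2) ≤ 0 := by
    rcases hz with rfl | hz
    · rw [sub_self, zero_mul]
    · refine mul_nonpos_of_nonneg_of_nonpos (by linarith) ?_
      linarith [Real.log_le_sub_one_of_pos h0, mul_le_mul_of_nonneg_left hyz hk]
  rw [psi]
  linarith

theorem choose_mul_exp_le {n t m : ℕ} (hn : 0 < n) {k z : ℝ} (hk : 0 ≤ k) (h0 : 0 < z)
    (htz : (t : ℝ) / n ≤ z) (hzm : z ≤ 1 - (m : ℝ) / n)
    (hz : z = (t : ℝ) / n ∨ (k + 1) * z ≤ 1) :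
    ((t + m).choose t : ℝ) * Real.exp (-(n * (k * ((t : ℝ) / n) ^ 2 / 2))) ≤
      Real.exp (psi k z) ^ n := by
  have hn0 : (0 : ℝ) < n := Nat.cast_pos.2 hn
  have hmn : 0 ≤ (m : ℝ) / n := by positivity
  have hm (hz1 : z = 1) : m = 0 := by
    have : (m : ℝ) / n = 0 := by linarith
    simpa [hn.ne'] using this
  have hpsi := entropy_sub_le_psi hk h0 htz hzm (sub_le_self 1 hmn) hz
  have ht : (n : ℝ) * (t / n) = t := mul_div_cancel₀ _ hn0.ne'
  have hm' : (n : ℝ) * (m / n) = m := mul_div_cancel₀ _ hn0.ne'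
  calc _ ≤ Real.exp (-t * Real.log z - m * Real.log (1 - z)) *
        Real.exp (-(n * (k * ((t : ℝ) / n) ^ 2 / 2))) := by
        gcongr
        exact choose_le_exp h0 (by linarith) t hm
    _ = Real.exp (n * (-(t / n) * Real.log z - (1 - (1 - m / n)) * Real.log (1 - z) -
          k * (t / n) ^ 2 / 2)) := by
        rw [← Real.exp_add]
        congr 1
        linear_combination Real.log z * ht + Real.log (1 - z) * hm'
    _ ≤ Real.exp (n * psi k z) := by gcongr
    _ = _ := Real.exp_nat_mul _ _

theorem one_sub_pow_choose_two_le {p : ℝ} (h0 : 0 ≤ p) (h1 : p ≤ 1) (t : ℕ) :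
    (1 - p) ^ (t + 1).choose 2 ≤ Real.exp (-(p * t ^ 2 / 2)) := by
  calc (1 - p) ^ (t + 1).choose 2 ≤ Real.exp (-p) ^ (t + 1).choose 2 :=
        pow_le_pow_left₀ (sub_nonneg.2 h1) (Real.one_sub_le_exp_neg p) _
    _ = Real.exp (-(p * t ^ 2 / 2) - p * t / 2) := by
        rw [← Real.exp_nat_mul, Nat.cast_choose_two]
        push_cast
        ring_nf
    _ ≤ _ := Real.exp_le_exp.2 (sub_le_self _ (by positivity))

-- The shift from `(t + 1, m)` to `(t, m)` preserves the potential and turns `(t + 1).choose 2`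
-- into `t ^ 2 / 2`.
theorem choose_succ_mul_pow_le {n t m : ℕ} (h : t + 1 + m ≤ n) {k z : ℝ} (hk : 0 ≤ k)
    {p : unitInterval} (hp : (p : ℝ) = k / n) (h0 : 0 < z) (htz : (t : ℝ) / n ≤ z)
    (hzm : z ≤ 1 - (m : ℝ) / n) (hz : z = (t : ℝ) / n ∨ (k + 1) * z ≤ 1) :
    ((t + 1 + m).choose (t + 1) : ℝ) * (1 - p : ℝ) ^ (t + 1).choose 2 ≤
      n * Real.exp (psi k z) ^ n := by
  have hn : 0 < n := by omega
  have hchoose : (t + 1 + m).choose (t + 1) ≤ n * (t + m).choose t := by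
    calc _ ≤ (t + 1 + m).choose (t + 1) * (t + 1) := Nat.le_mul_of_pos_right _ t.succ_pos
      _ = (t + m + 1) * (t + m).choose t := by
          rw [Nat.add_one_mul_choose_eq, add_right_comm]
      _ ≤ _ := Nat.mul_le_mul_right _ (by omega)
  have hexponent : (p : ℝ) * t ^ 2 / 2 = n * (k * ((t : ℝ) / n) ^ 2 / 2) := by
    rw [hp]
    field_simp
  calc _ ≤ (n * (t + m).choose t : ℝ) * Real.exp (-(n * (k * ((t : ℝ) / n) ^ 2 / 2))) := by
        refine mul_le_mul (by exact_mod_cast hchoose) ?_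
          (pow_nonneg (sub_nonneg.2 p.2.2) _) (by positivity)
        exact hexponent ▸ one_sub_pow_choose_two_le p.2.1 p.2.2 t
    _ = n * ((t + m).choose t * Real.exp (-(n * (k * ((t : ℝ) / n) ^ 2 / 2)))) := mul_assoc _ _ _
    _ ≤ _ := by
        gcongr
        exact choose_mul_exp_le hn hk h0 htz hzm hz

-- If `1 / x ≤ k + 1`, then `z = max y (1 / (k + 1))` makes `mu k (1 / z)` irrelevant.
theorem le_mul_gamma_pow {k x y a c : ℝ} {n : ℕ} (hk : 0 ≤ k) (hx : x ∈ Set.Ioc (0 : ℝ) 1)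
    (hyx : y ≤ x) (hc : 0 ≤ c)
    (hpsi : ∀ z, 0 < z → y ≤ z → z ≤ x → (z = y ∨ (k + 1) * z ≤ 1) →
      a ≤ c * Real.exp (psi k z) ^ n)
    (hmu : k + 1 < 1 / x → a ≤ c * Real.exp (mu k (1 / x) / 2) ^ n) :
    a ≤ c * gamma k ^ n := by
  obtain ⟨hx0, hx1⟩ := hx
  have hk1 : 0 < k + 1 := by linarith
  rcases le_or_gt (1 / x) (k + 1) with hkx | hkx
  · set z : ℝ := max y (1 / (k + 1)) with hz
    have hz0 : 0 < z := lt_max_of_lt_right (one_div_pos.2 hk1)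
    have hzx : z ≤ x := max_le hyx ((one_div_le hx0 hk1).1 hkx)
    have hzy : z = y ∨ (k + 1) * z ≤ 1 :=
      (max_choice y (1 / (k + 1))).imp_right fun h => by rw [hz, h, mul_one_div_cancel hk1.ne']
    refine (hpsi z hz0 (le_max_left _ _) hzx hzy).trans ?_
    gcongr
    exact exp_psi_le_gamma hk ⟨hz0, hzx.trans hx1⟩ ((one_div_le hz0 hk1).2 (le_max_right _ _))
  · have hxk : (k + 1) * x ≤ 1 := ((lt_div_iff₀ hx0).1 hkx).le
    calc a ≤ c * Real.exp (min (psi k x) (mu k (1 / x) / 2)) ^ n := by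
          rcases min_choice (psi k x) (mu k (1 / x) / 2) with h | h <;> rw [h]
          · exact hpsi x hx0 hyx le_rfl (Or.inr hxk)
          · exact hmu hkx
      _ ≤ c * gamma k ^ n := by
          gcongr
          exact exp_min_le_gamma hk ⟨hx0, hx1⟩

theorem choose_mul_binomialRandom_real_indepNum_le {n : ℕ} {k : ℝ} (hk : 0 < k) {p : unitInterval}
    (hp : (p : ℝ) = k / n) {s i b : ℕ} (hi : i ≤ n) (hb : k + 1 < (n : ℝ) / b) :
    (i.choose s : ℝ) * (SimpleGraph.binomialRandom (Fin n) p).real {G | G.indepNum ≤ b} ≤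
      Real.exp (mu k (n / b) / 2) ^ n := by
  have hpn : (p : ℝ) * Fintype.card (Fin n) ≤ k := by
    rw [hp, Fintype.card_fin]
    exact mul_le_of_le_div₀ hk.le n.cast_nonneg le_rfl
  have htail := binomialRandom_real_indepNum_le hk hpn (b := b) (by rwa [Fintype.card_fin])
  rw [Fintype.card_fin] at htail
  have hchoose : (i.choose s : ℝ) ≤ Real.exp (n * Real.log 2) := by
    rw [Real.exp_nat_mul, Real.exp_log two_pos]
    exact_mod_cast (Nat.choose_le_two_pow i s).trans (Nat.pow_le_pow_right two_pos hi)
  calc _ ≤ Real.exp (n * Real.log 2) * Real.exp (n * (mu k (n / b) / 2 - Real.log 2)) := by gcongr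
    _ = _ := by
        rw [← Real.exp_add, ← Real.exp_nat_mul]
        ring_nf

theorem choose_mul_binomialRandom_real_le {n : ℕ} (hn : 0 < n) {k : ℝ} (hk : 0 < k)
    {p : unitInterval} (hp : (p : ℝ) = k / n) {S : Finset (Fin n)} {m : ℕ}
    (h : S.card + m ≤ n) :
    ((S.card + m).choose S.card : ℝ) * (SimpleGraph.binomialRandom (Fin n) p).real
      {G | G.IsIndepSet (S : Set (Fin n)) ∧ G.indepNum ≤ n - m} ≤ n * gamma k ^ n := by
  have hn0 : (0 : ℝ) < n := Nat.cast_pos.2 hn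
  have hn1 : (1 : ℝ) ≤ n := Nat.one_le_cast.2 hn
  have hindep : (SimpleGraph.binomialRandom (Fin n) p).real
      {G | G.IsIndepSet (S : Set (Fin n)) ∧ G.indepNum ≤ n - m} ≤ (1 - p : ℝ) ^ S.card.choose 2 :=
    (measureReal_mono fun _ hG => hG.1).trans_eq (binomialRandom_real_isIndepSet p S)
  have htail : (SimpleGraph.binomialRandom (Fin n) p).real
      {G | G.IsIndepSet (S : Set (Fin n)) ∧ G.indepNum ≤ n - m} ≤
        (SimpleGraph.binomialRandom (Fin n) p).real {G | G.indepNum ≤ n - m} :=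
    measureReal_mono fun _ hG => hG.2
  cases hS : S.card with
  | zero =>
    rw [Nat.choose_zero_right, Nat.cast_one, one_mul]
    exact measureReal_le_one.trans (one_le_mul_of_one_le_of_one_le hn1
      (one_le_pow₀ (one_le_gamma hk.le)))
  | succ t =>
    rw [hS] at h hindep
    have hmn : ((n - m : ℕ) : ℝ) = n - m := Nat.cast_sub (by omega)
    have hx : 1 - (m : ℝ) / n = (n - m : ℕ) / n := by rw [hmn, sub_div, div_self hn0.ne']
    have ht : (t : ℝ) ≤ (n - m : ℕ) := Nat.cast_le.2 (by omega)
    have hm0 : 0 < n - m := by omega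
    refine le_mul_gamma_pow hk.le (x := 1 - (m : ℝ) / n) (y := t / n)
      ⟨by rw [hx]; positivity, sub_le_self 1 (by positivity)⟩ (by rw [hx]; gcongr) hn0.le
      (fun z h0 htz hzm hz => ?_) fun hkx => ?_
    · exact (mul_le_mul_of_nonneg_left hindep (Nat.cast_nonneg _)).trans
        (choose_succ_mul_pow_le h hk.le hp h0 htz hzm hz)
    · rw [hx, one_div_div] at hkx ⊢
      exact ((mul_le_mul_of_nonneg_left htail (Nat.cast_nonneg _)).trans
        (choose_mul_binomialRandom_real_indepNum_le hk hp h hkx)).trans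
        (le_mul_of_one_le_left (by positivity) hn1)

theorem binomialRandom_real_le_of_mem_decisionTree {n : ℕ} (hn : 0 < n) {k : ℝ} (hk : 0 < k)
    {p : unitInterval} (hp : (p : ℝ) = k / n) {t : Node n} (ht : t ∈ decisionTree n) :
    (SimpleGraph.binomialRandom (Fin n) p).real
        {G | G.IsIndepSet (t.chosen : Set (Fin n)) ∧ G.indepNum ≤ t.potential} ≤
      n * gamma k ^ n * (t.level.choose t.chosen.card : ℝ)⁻¹ := by
  obtain ⟨hlevel, hchosen⟩ := mem_decisionTree.1 ht
  have hcard : t.chosen.card ≤ t.level :=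
    (Finset.card_le_card hchosen).trans_eq (card_decided hlevel)
  have hpos : (0 : ℝ) < t.level.choose t.chosen.card := Nat.cast_pos.2 (Nat.choose_pos hcard)
  have hpotential : t.potential = n - (t.level - t.chosen.card) := by
    unfold Node.potential
    omega
  have hbound := choose_mul_binomialRandom_real_le hn hk hp
    (S := t.chosen) (m := t.level - t.chosen.card) (by omega)
  rw [Nat.add_sub_cancel' hcard, ← hpotential] at hbound
  rwa [← div_eq_mul_inv, le_div_iff₀' hpos]

theorem sum_inv_choose_decisionTree (n : ℕ) :
    ∑ t ∈ decisionTree n, (t.level.choose t.chosen.card : ℝ)⁻¹ =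
      ∑ i ∈ Finset.range (n + 1), ((i : ℝ) + 1) := by
  rw [sum_decisionTree]
  refine Finset.sum_congr rfl fun i hi => ?_
  rw [Finset.sum_powerset_apply_card (fun s => (i.choose s : ℝ)⁻¹),
    card_decided (Nat.lt_succ_iff.1 (Finset.mem_range.1 hi))]
  have hterm (s : ℕ) (hs : s ∈ Finset.range (i + 1)) :
      i.choose s • (i.choose s : ℝ)⁻¹ = 1 := by
    rw [nsmul_eq_mul, mul_inv_cancel₀ (Nat.cast_ne_zero.2
      (Nat.choose_pos (Nat.lt_succ_iff.1 (Finset.mem_range.1 hs))).ne')]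
  rw [Finset.sum_congr rfl hterm, Finset.sum_const, Finset.card_range, nsmul_one, Nat.cast_succ]

theorem sum_inv_choose_decisionTree_le {n : ℕ} (hn : 0 < n) :
    ∑ t ∈ decisionTree n, (t.level.choose t.chosen.card : ℝ)⁻¹ ≤ 4 * (n : ℝ) ^ 2 := by
  have hn1 : (1 : ℝ) ≤ n := Nat.one_le_cast.2 hn
  rw [sum_inv_choose_decisionTree]
  calc ∑ i ∈ Finset.range (n + 1), ((i : ℝ) + 1) ≤ ∑ _i ∈ Finset.range (n + 1), ((n : ℝ) + 1) :=
        Finset.sum_le_sum fun i hi => by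
          gcongr
          exact Nat.lt_succ_iff.1 (Finset.mem_range.1 hi)
    _ = ((n : ℝ) + 1) * (n + 1) := by
        rw [Finset.sum_const, Finset.card_range, nsmul_eq_mul, Nat.cast_succ]
    _ ≤ 4 * (n : ℝ) ^ 2 := by nlinarith

theorem averageRunningTime_le_gamma {n : ℕ} (hn : 0 < n) {k : ℝ} (hk : 0 < k) {p : unitInterval}
    (hp : (p : ℝ) = k / n) :
    averageRunningTime n p ≤ ENNReal.ofReal (4 * (n : ℝ) ^ 3 * gamma k ^ n) := by
  have hγ : 0 ≤ gamma k := zero_le_one.trans (one_le_gamma hk.le)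
  refine (averageRunningTime_le_sum n p).trans (ENNReal.ofReal_le_ofReal ?_)
  calc _ ≤ ∑ t ∈ decisionTree n, n * gamma k ^ n * (t.level.choose t.chosen.card : ℝ)⁻¹ :=
        Finset.sum_le_sum fun t ht => binomialRandom_real_le_of_mem_decisionTree hn hk hp ht
    _ ≤ n * gamma k ^ n * (4 * (n : ℝ) ^ 2) := by
        rw [← Finset.mul_sum]
        exact mul_le_mul_of_nonneg_left (sum_inv_choose_decisionTree_le hn) (by positivity)
    _ = _ := by ring

theorem exists_forall_pow_mul_pow_le (d : ℕ) {a b : ℝ} (ha : 0 ≤ a) (hab : a < b) :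
    ∃ C : ℝ, ∀ n : ℕ, (n : ℝ) ^ d * a ^ n ≤ C * b ^ n := by
  have hb : 0 < b := ha.trans_lt hab
  have hlim := tendsto_pow_const_mul_const_pow_of_abs_lt_one d (r := a / b)
    (by rwa [abs_of_nonneg (by positivity), div_lt_one hb])
  obtain ⟨C, hC⟩ := hlim.bddAbove_range
  refine ⟨C, fun n => (div_le_iff₀ (pow_pos hb n)).1 ?_⟩
  rw [mul_div_assoc, ← div_pow]
  exact hC ⟨n, rfl⟩

theorem exists_forall_averageRunningTime_le {β : ℝ} (hβ : 1.8668 < β) :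
    ∃ C : ℝ, ∀ k : ℝ, 0 < k → ∀ n : ℕ, 0 < n → ∀ p : unitInterval, (p : ℝ) = k / n →
      averageRunningTime n p ≤ ENNReal.ofReal (C * β ^ n) := by
  obtain ⟨C, hC⟩ := exists_forall_pow_mul_pow_le 3 (by norm_num) hβ
  refine ⟨4 * C, fun k hk n hn p hp =>
    (averageRunningTime_le_gamma hn hk hp).trans (ENNReal.ofReal_le_ofReal ?_)⟩
  have hγ : 0 ≤ gamma k := zero_le_one.trans (one_le_gamma hk.le)
  calc 4 * (n : ℝ) ^ 3 * gamma k ^ n ≤ 4 * (n : ℝ) ^ 3 * 1.8668 ^ n := by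
        gcongr
        exact gamma_le hk
    _ = 4 * ((n : ℝ) ^ 3 * 1.8668 ^ n) := mul_assoc _ _ _
    _ ≤ 4 * (C * β ^ n) := mul_le_mul_of_nonneg_left (hC n) (by norm_num)
    _ = 4 * C * β ^ n := (mul_assoc _ _ _).symm

end AverageRunningTime

end BranchAndBound

theorem theorem4 :
    -- the average running time for `p = k / n` is at most `γ(k) ^ n`, up to a polynomial factor
    (∃ (C : ℝ) (d : ℕ), ∀ k : ℝ, 0 < k → ∀ n : ℕ, 0 < n → ∀ p : unitInterval, (p : ℝ) = k / n →
      BranchAndBound.averageRunningTime n p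
        ≤ ENNReal.ofReal (C * (n : ℝ) ^ d * BranchAndBound.gamma k ^ n)) ∧
    -- it is `O(1.867 ^ n)`
    (∃ C : ℝ, ∀ k : ℝ, 0 < k → ∀ n : ℕ, 0 < n → ∀ p : unitInterval, (p : ℝ) = k / n →
      BranchAndBound.averageRunningTime n p ≤ ENNReal.ofReal (C * (1.867 : ℝ) ^ n)) ∧
    -- up to an error of `0.001`, the largest value of `γ` is `γ(0.47)`
    (∀ k : ℝ, 0 < k → BranchAndBound.gamma k ≤ BranchAndBound.gamma 0.47 + 0.001) ∧
    BranchAndBound.gamma 0.47 ≤ 1.867 ∧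
    (∀ k : ℝ, 0 < k → BranchAndBound.gamma k ≤ 1.867) ∧
    Filter.Tendsto BranchAndBound.gamma (nhdsWithin 0 (Set.Ioi 0)) (nhds 1) ∧
    Filter.Tendsto BranchAndBound.gamma Filter.atTop (nhds 1) := by
  refine ⟨⟨4, 3, fun k hk n hn p hp => BranchAndBound.averageRunningTime_le_gamma hn hk hp⟩,
    BranchAndBound.exists_forall_averageRunningTime_le (by norm_num), fun k hk => ?_,
    (BranchAndBound.gamma_le (by norm_num)).trans (by norm_num),
    fun k hk => (BranchAndBound.gamma_le hk).trans (by norm_num),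
    BranchAndBound.tendsto_gamma_zero, BranchAndBound.tendsto_gamma_atTop⟩
  calc BranchAndBound.gamma k ≤ 1.8668 := BranchAndBound.gamma_le hk
    _ ≤ 1.866 + 0.001 := by norm_num
    _ ≤ BranchAndBound.gamma 0.47 + 0.001 :=
      add_le_add_left BranchAndBound.le_gamma_zero_point_forty_seven _
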